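/- Let $n\ge 2$ and let $\mathcal F_n$ be the unital free semigroup on $n$ generators. Let $\mathcal H_n=\ell^2(\mathcal F_n)$ be Fock space with orthonormal basis $\{\xi_w\}_{w\in\mathcal F_n}$, let $L_1,\dots,L_n$ be the isometries $L_i\xi_w=\xi_{iw}$, and let $\mathfrak L_n$ be the closure in the weak operator topology of the unital algebra generated by the $L_i$. For an $n$-tuple $A=(A_1,\dots,A_n)$ of bounded operators on a complex Hilbert space $\mathcal H$ put $\Phi_A(X)=\sum_{i=1}^n A_iXA_i^*$. Call $A$ a contraction if $\Phi_A(I)\le I$, and a pure contraction if in addition $\Phi_A^k(I)\to 0$ in the strong operator topology. The pure rank of $A$ is the rank of $I-\sum_{i=1}^n S_iS_i^*$, where $S=(S_1,\dots,S_n)$ is the minimal isometric dilation of $A$: the $S_i$ are isometries with pairwise orthogonal ranges on a Hilbert space $\mathcal K\supseteq\mathcal H$, $A_i=P_{\mathcal H}S_i|_{\mathcal H}$, $S_i^*\mathcal H\subseteq\mathcal H$, and $\mathcal K$ is the closed span of the subspaces $S_w\mathcal H$, $w\in\mathcal F_n$, where $S_w=S_{i_1}\cdots S_{i_d}$ for $w=i_1\cdots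 i_d$. The curvature invariant and the Euler characteristic of $A$ are \[ K(A)=(n-1)\lim_{l\to\infty}\frac{\operatorname{tr}(I-\Phi_A^l(I))}{n^l},\qquad \chi(A)=(n-1)\lim_{l\to\infty}\frac{\operatorname{rk}(I-\Phi_A^l(I))}{n^l}. \] Theorem. Let $A$ be a pure contraction acting on $\mathcal H$ with pure rank $1$, and regard $\mathcal H$ as a subspace of $\mathcal H_n$ such that $L=(L_1,\dots,L_n)$ is the minimal isometric dilation of $A$ (so that $\mathcal H$ is co-invariant for the $L_i$ and $A_i=P_{\mathcal H}L_i|_{\mathcal H}$). Suppose that $\mathcal H^\perp$ is a cyclic $\mathfrak L_n$-invariant subspace of $\mathcal H_n$, that is, $\mathcal H^\perp$ is $\mathfrak L_n$-invariant and equals $\overline{\mathfrak L_n x}$ for some $x\in\mathcal H^\perp$. Let $k\ge 0$ be an integer. If $\mathcal H$ contains $\operatorname{span}\{\xi_w:|w|\le k\}$, then the limits defining $K(A)$ and $\chi(A)$ exist and \[ \chi(A)\ \ge\ K(A)\ >\ 1-\frac1{n^k}. \] -/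

import Mathlib

open Filter Topology
open scoped ENNReal

noncomputable section

/-! ### Row contractions and their completely positive maps -/

section Tuples

variable {n : ℕ} {H : Type*} [NormedAddCommGroup H] [InnerProductSpace ℂ H] [CompleteSpace H]

/-- The completely positive map `Φ_A(X) = ∑ i, A i * X * (A i)†` of an `n`-tuple of operators. -/
def cpMap (A : Fin n → (H →L[ℂ] H)) (X : H →L[ℂ] H) : H →L[ℂ] H :=
  ∑ i, A i * X * ContinuousLinearMap.adjoint (A i)

/-- `A` is a (row) contraction: `∑ i, A i * (A i)† ≤ I`. -/
def IsRowContraction (A : Fin n → (H →L[ℂ] H)) : Prop :=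
  cpMap A 1 ≤ 1

/-- `A` is a pure contraction: a row contraction for which `Φ_A^k(I) → 0` in the strong operator
topology. -/
def IsPureContraction (A : Fin n → (H →L[ℂ] H)) : Prop :=
  IsRowContraction A ∧ ∀ x : H, Tendsto (fun k : ℕ => (cpMap A)^[k] 1 x) atTop (𝓝 0)

/-- The defect operator `I - Φ_A^k(I)`. -/
def defect (A : Fin n → (H →L[ℂ] H)) (k : ℕ) : H →L[ℂ] H :=
  1 - (cpMap A)^[k] 1

/-- The operator `A_w = A_{i₁} ⋯ A_{i_d}` of a word `w = i₁ ⋯ i_d`. -/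
def wordOp (A : Fin n → (H →L[ℂ] H)) (w : FreeMonoid (Fin n)) : H →L[ℂ] H :=
  FreeMonoid.lift A w

end Tuples

/-! ### Rank, trace and the two invariants -/

section Invariants

variable {n : ℕ} {H : Type*} [NormedAddCommGroup H] [InnerProductSpace ℂ H] [CompleteSpace H]

/-- The rank of an operator: the dimension of its range, `⊤` when that is infinite. -/
def opRank (T : H →L[ℂ] H) : ℕ∞ :=
  Cardinal.toENat (LinearMap.rank (T : H →ₗ[ℂ] H))

/-- The index set of a chosen Hilbert basis of `H`. -/
def chosenBasisSet (H : Type*) [NormedAddCommGroup H] [InnerProductSpace ℂ H]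
    [CompleteSpace H] : Set H :=
  (exists_hilbertBasis ℂ H).choose

/-- A chosen Hilbert basis of `H`. -/
def chosenBasis (H : Type*) [NormedAddCommGroup H] [InnerProductSpace ℂ H]
    [CompleteSpace H] : HilbertBasis (chosenBasisSet H) ℂ H :=
  (exists_hilbertBasis ℂ H).choose_spec.choose

/-- The trace, in `[0, ∞]`, of a positive operator: `∑ ⟪b, T b⟫` over a Hilbert basis. It does not
depend on the basis, see `opTrace_eq_tsum`. -/
def opTrace (T : H →L[ℂ] H) : ℝ≥0∞ :=
  ∑' i, ENNReal.ofReal (T.reApplyInnerSelf (chosenBasis H i))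

theorem hilbertBasis_tsum_ofReal {ι : Type*} (b : HilbertBasis ι ℂ H) (x : H) :
    ∑' i, ENNReal.ofReal (‖inner ℂ (b i) x‖ ^ 2) = ENNReal.ofReal (‖x‖ ^ 2) := by
  have h2 : HasSum (fun i => ‖inner ℂ (b i) x‖ ^ 2) (‖x‖ ^ 2) := by
    have h := RCLike.hasSum_re ℂ (b.hasSum_inner_mul_inner x x)
    rw [inner_self_eq_norm_sq (𝕜 := ℂ) x] at h
    convert h using 2 with i
    rw [inner_mul_symm_re_eq_norm, norm_mul, norm_inner_symm x (b i), sq]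
  rw [← ENNReal.ofReal_tsum_of_nonneg (fun i => by positivity) h2.summable, h2.tsum_eq]

theorem tsum_norm_sq_eq_adjoint {ι κ : Type*} (R : H →L[ℂ] H) (b : HilbertBasis ι ℂ H)
    (c : HilbertBasis κ ℂ H) :
    ∑' i, ENNReal.ofReal (‖R (c i)‖ ^ 2) =
      ∑' j, ENNReal.ofReal (‖ContinuousLinearMap.adjoint R (b j)‖ ^ 2) := by
  have h1 : ∀ i, ENNReal.ofReal (‖R (c i)‖ ^ 2) =
      ∑' j, ENNReal.ofReal (‖inner ℂ (b j) (R (c i))‖ ^ 2) :=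
    fun i => (hilbertBasis_tsum_ofReal b _).symm
  have h2 : ∀ j, ENNReal.ofReal (‖ContinuousLinearMap.adjoint R (b j)‖ ^ 2) =
      ∑' i, ENNReal.ofReal (‖inner ℂ (b j) (R (c i))‖ ^ 2) := by
    intro j
    rw [← hilbertBasis_tsum_ofReal c]
    refine tsum_congr fun i => ?_
    rw [ContinuousLinearMap.adjoint_inner_right, norm_inner_symm]
  simp_rw [h1, h2]
  exact ENNReal.tsum_comm

/-- The trace of a positive operator may be computed in any Hilbert basis. -/
theorem opTrace_eq_tsum {ι : Type*} (T : H →L[ℂ] H) (hT : T.IsPositive)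
    (b : HilbertBasis ι ℂ H) :
    opTrace T = ∑' i, ENNReal.ofReal (T.reApplyInnerSelf (b i)) := by
  obtain ⟨R, hR⟩ := CStarAlgebra.nonneg_iff_eq_star_mul_self.mp
    ((ContinuousLinearMap.nonneg_iff_isPositive T).mpr hT)
  have key : ∀ x, T.reApplyInnerSelf x = ‖R x‖ ^ 2 := by
    intro x
    rw [hR, ContinuousLinearMap.reApplyInnerSelf_apply, ContinuousLinearMap.star_eq_adjoint,
      mul_apply_eq_comp, ContinuousLinearMap.adjoint_inner_left,
      inner_self_eq_norm_sq]
  unfold opTrace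
  simp_rw [key]
  rw [tsum_norm_sq_eq_adjoint R b (chosenBasis H), tsum_norm_sq_eq_adjoint R b b]

/-- The sequence `(n - 1) tr(I - Φ_A^k(I)) / n^k`. -/
def curvatureSeq (A : Fin n → (H →L[ℂ] H)) (k : ℕ) : ℝ≥0∞ :=
  ((n - 1 : ℕ) : ℝ≥0∞) * (opTrace (defect A k) / (n : ℝ≥0∞) ^ k)

/-- The sequence `(n - 1) rk(I - Φ_A^k(I)) / n^k`. -/
def eulerSeq (A : Fin n → (H →L[ℂ] H)) (k : ℕ) : ℝ≥0∞ :=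
  ((n - 1 : ℕ) : ℝ≥0∞) * ((opRank (defect A k) : ℝ≥0∞) / (n : ℝ≥0∞) ^ k)

/-- The curvature invariant `K(A) = (n - 1) lim tr(I - Φ_A^k(I)) / n^k`. -/
def curvatureInvariant (A : Fin n → (H →L[ℂ] H)) : ℝ≥0∞ :=
  limUnder atTop (curvatureSeq A)

/-- The Euler characteristic `χ(A) = (n - 1) lim rk(I - Φ_A^k(I)) / n^k`. -/
def eulerCharacteristic (A : Fin n → (H →L[ℂ] H)) : ℝ≥0∞ :=
  limUnder atTop (eulerSeq A)

end Invariants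

/-! ### Minimal isometric dilations and the pure rank -/

/-- `S`, acting on `K`, is the minimal isometric dilation of `A`, acting on `H`, where `H` is
regarded as a subspace of `K` through the isometry `V`. -/
structure IsMinimalIsometricDilation {n : ℕ} {H K : Type*}
    [NormedAddCommGroup H] [InnerProductSpace ℂ H] [CompleteSpace H]
    [NormedAddCommGroup K] [InnerProductSpace ℂ K] [CompleteSpace K]
    (A : Fin n → (H →L[ℂ] H)) (S : Fin n → (K →L[ℂ] K)) (V : H →ₗᵢ[ℂ] K) : Prop where
  /-- The `S i` are isometries with pairwise orthogonal ranges. -/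
  isometries : ∀ i j, ContinuousLinearMap.adjoint (S i) * S j = if i = j then 1 else 0
  /-- Each `A i` is the compression of `S i` to `H`. -/
  compression : ∀ i x,
    A i x = ContinuousLinearMap.adjoint V.toContinuousLinearMap (S i (V x))
  /-- `H` is co-invariant for the `S i`. -/
  coinvariant : ∀ i x,
    ContinuousLinearMap.adjoint (S i) (V x) ∈ LinearMap.range V.toLinearMap
  /-- The closed span of the subspaces `S_w H` is all of `K`. -/
  minimal : (Submodule.span ℂ
    {y : K | ∃ (w : FreeMonoid (Fin n)) (x : H), y = wordOp S w (V x)}).topologicalClosure = ⊤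

/-- The pure rank of `A` is `r`: the rank of `I - ∑ S i (S i)†` is `r`, for the minimal isometric
dilation `S` of `A` (which is unique up to unitary equivalence). -/
def HasPureRank.{u} {n : ℕ} {H : Type u}
    [NormedAddCommGroup H] [InnerProductSpace ℂ H] [CompleteSpace H]
    (A : Fin n → (H →L[ℂ] H)) (r : ℕ∞) : Prop :=
  ∃ (K : Type u) (_ : NormedAddCommGroup K) (_ : InnerProductSpace ℂ K) (_ : CompleteSpace K)
    (S : Fin n → (K →L[ℂ] K)) (V : H →ₗᵢ[ℂ] K),
    IsMinimalIsometricDilation A S V ∧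
      opRank (1 - ∑ i, S i * ContinuousLinearMap.adjoint (S i)) = r

/-! ### Fock space, the left creation operators and their algebra -/

/-- The `n`-variable Fock space `ℓ²` of the free semigroup on `n` generators. -/
abbrev FockSpace (n : ℕ) : Type := lp (fun _ : FreeMonoid (Fin n) => ℂ) 2

open Classical in
/-- The orthonormal basis vector `ξ_w`. -/
def fockVec {n : ℕ} (w : FreeMonoid (Fin n)) : FockSpace n :=
  lp.single 2 w 1

open Classical in
theorem fockVec_orthonormal (n : ℕ) :
    Orthonormal ℂ (fun w : FreeMonoid (Fin n) => fockVec w) := by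
  rw [orthonormal_iff_ite]
  intro v w
  simp only [fockVec, lp.inner_single_left, lp.single_apply]
  by_cases h : v = w
  · subst h; simp
  · simp [h]

theorem fockVec_shift_orthonormal {n : ℕ} (i : Fin n) :
    Orthonormal ℂ (fun w : FreeMonoid (Fin n) => fockVec (FreeMonoid.of i * w)) :=
  (fockVec_orthonormal n).comp (fun w => FreeMonoid.of i * w) (mul_right_injective (FreeMonoid.of i))

/-- The left creation operator `L_i`, the isometry with `L_i ξ_w = ξ_{iw}`. -/
def leftCreation {n : ℕ} (i : Fin n) : FockSpace n →L[ℂ] FockSpace n :=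
  (fockVec_shift_orthonormal i).orthogonalFamily.linearIsometry.toContinuousLinearMap

open Classical in
theorem leftCreation_fockVec {n : ℕ} (i : Fin n) (w : FreeMonoid (Fin n)) :
    leftCreation i (fockVec w) = fockVec (FreeMonoid.of i * w) := by
  simp [leftCreation, fockVec]

/-- The non-commutative analytic Toeplitz algebra `𝔏_n`: the closure, in the weak operator topology,
of the unital algebra generated by the left creation operators. -/
def analyticToeplitz (n : ℕ) : Set (FockSpace n →L[ℂ] FockSpace n) :=
  {T | ContinuousLinearMapWOT.ofCLM T ∈
    closure (ContinuousLinearMapWOT.ofCLM ''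
      (Algebra.adjoin ℂ (Set.range (leftCreation (n := n))) :
        Set (FockSpace n →L[ℂ] FockSpace n)))}

/-- `M` is a cyclic `𝔏_n`-invariant subspace: it is invariant for `𝔏_n`, and it is the closure of
`𝔏_n x` for some `x ∈ M`. -/
def IsCyclicInvariant {n : ℕ} (M : Submodule ℂ (FockSpace n)) : Prop :=
  (∀ T ∈ analyticToeplitz n, ∀ y ∈ M, T y ∈ M) ∧
    ∃ x ∈ M, (M : Set (FockSpace n)) = closure {y | ∃ T ∈ analyticToeplitz n, y = T x}

end

/-! Write `P` for the projection onto `H`. Since `I - ∑ L_i L_i†` is the projection onto `ξ_1` and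
`H` is co-invariant, `I - Φ_A(I)` is the rank one operator of `P ξ_1`, and iterating makes `I -
Φ_A^l(I)` the sum of the rank one operators of `P ξ_w`, `|w| < l` (`defect_apply`). So its trace is
`∑ ‖P ξ_w‖²` and its rank is the dimension of the span of these vectors. Both satisfy `s (l+1) ≤ 1 +
n s l`, which forces the limits to exist, and trace ≤ rank by Bessel.

For the lower bound, `H^⊥` is the closed span of the orbit `L_w x`. As `x` is orthogonal to all
words of length at most `k`, `L_w x` is orthogonal to those of length less than `|w| + k + 1`. Hence
words shorter than `j + k + 1` see only the orbit vectors with `|w| < j`, and their total mass in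
`H^⊥` is at most the number of such `w` (`sum_norm_sq_starProjection_le`). The trace at level `j + k
+ 1` is thus at least `(n^(j+k+1) - n^j) / (n - 1)`, so `K(A) ≥ 1 - n^(-(k+1)) > 1 - n^(-k)`. -/

open ContinuousLinearMap

/-! ### Words of bounded length -/

/-- Prepending a letter, as an embedding of pairs into words. -/
def consWord (n : ℕ) : Fin n × FreeMonoid (Fin n) ↪ FreeMonoid (Fin n) where
  toFun p := FreeMonoid.of p.1 * p.2
  inj' := by
    rintro ⟨i, v⟩ ⟨j, w⟩ h
    have h' : i :: FreeMonoid.toList v = j :: FreeMonoid.toList w := by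
      simpa using congrArg FreeMonoid.toList h
    obtain ⟨rfl, h2⟩ := List.cons.inj h'
    exact Prod.ext rfl (FreeMonoid.toList.injective h2)

theorem consWord_ne_one {n : ℕ} (p : Fin n × FreeMonoid (Fin n)) : consWord n p ≠ 1 := by
  intro h
  have := congrArg FreeMonoid.length h
  change (FreeMonoid.of p.1 * p.2).length = _ at this
  simp [FreeMonoid.length_mul] at this

/-- The finite set of words of length less than `l`. -/
def shortWords (n : ℕ) : ℕ → Finset (FreeMonoid (Fin n))
  | 0 => ∅
  | l + 1 => Finset.cons 1 ((Finset.univ ×ˢ shortWords n l).map (consWord n)) (by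
      intro h
      obtain ⟨p, _, hp⟩ := Finset.mem_map.mp h
      exact consWord_ne_one p hp)

theorem sum_shortWords_succ {n : ℕ} {E : Type*} [AddCommMonoid E] (l : ℕ)
    (f : FreeMonoid (Fin n) → E) :
    ∑ w ∈ shortWords n (l + 1), f w =
      f 1 + ∑ i, ∑ w ∈ shortWords n l, f (FreeMonoid.of i * w) := by
  rw [shortWords, Finset.sum_cons, Finset.sum_map, Finset.sum_product]
  rfl

theorem mem_shortWords {n : ℕ} (l : ℕ) (w : FreeMonoid (Fin n)) :
    w ∈ shortWords n l ↔ w.length < l := by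
  induction l generalizing w with
  | zero => simp [shortWords]
  | succ l ih =>
    rw [shortWords, Finset.mem_cons, Finset.mem_map]
    induction w using FreeMonoid.casesOn with
    | one => simp
    | of_mul i v =>
      constructor
      · rintro (h | ⟨p, hp, h⟩)
        · exact absurd h (consWord_ne_one (i, v))
        · rw [← h]
          have := (ih p.2).mp (Finset.mem_product.mp hp).2
          change (FreeMonoid.of p.1 * p.2).length < l + 1
          rw [FreeMonoid.length_mul, FreeMonoid.length_of]
          omega
      · intro h
        refine Or.inr ⟨(i, v), ?_, rfl⟩
        rw [FreeMonoid.length_mul, FreeMonoid.length_of] at h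
        exact Finset.mem_product.mpr ⟨Finset.mem_univ _, (ih v).mpr (by omega)⟩

theorem card_shortWords (n l : ℕ) :
    ((n : ℝ) - 1) * ((shortWords n l).card : ℝ) = (n : ℝ) ^ l - 1 := by
  induction l with
  | zero => simp [shortWords]
  | succ l ih =>
    have h : ((shortWords n (l + 1)).card : ℝ) = 1 + n * (shortWords n l).card := by
      simp [shortWords]; ring
    rw [h, pow_succ]
    linear_combination (n : ℝ) * ih

/-! ### A growth lemma -/

/-- The shifted sequence `(n - 1) s + 1` grows by a factor at most `n` per step, so after division
by `n^l` it is antitone and bounded below. The shift contributes only `n^(-l)`, which vanishes in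
the limit. -/
theorem exists_tendsto_of_le_one_add_mul {n : ℕ} (hn : 2 ≤ n) (s : ℕ → ℝ) (h0 : ∀ l, 0 ≤ s l)
    (hs : ∀ l, s (l + 1) ≤ 1 + n * s l) :
    ∃ c : ℝ, Tendsto (fun l => ((n : ℝ) - 1) * (s l / (n : ℝ) ^ l)) atTop (𝓝 c) := by
  have hn' : (2 : ℝ) ≤ n := by exact_mod_cast hn
  have hpos : (0 : ℝ) < n := by linarith
  let u : ℕ → ℝ := fun l => (((n : ℝ) - 1) * s l + 1) / (n : ℝ) ^ l
  have hanti : Antitone u := by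
    refine antitone_nat_of_succ_le fun l => ?_
    simp only [u]
    rw [div_le_div_iff₀ (by positivity) (by positivity), pow_succ]
    have : ((n : ℝ) - 1) * s (l + 1) + 1 ≤ (((n : ℝ) - 1) * s l + 1) * n := by
      nlinarith [hs l]
    nlinarith [pow_pos hpos l]
  have hbdd : BddBelow (Set.range u) := by
    refine ⟨0, ?_⟩
    rintro _ ⟨l, rfl⟩
    have := mul_nonneg (by linarith : (0 : ℝ) ≤ n - 1) (h0 l)
    positivity
  have h1 := tendsto_atTop_ciInf hanti hbdd
  have h2 : Tendsto (fun l : ℕ => ((n : ℝ) ^ l)⁻¹) atTop (𝓝 0) := by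
    simpa using tendsto_pow_atTop_nhds_zero_of_lt_one (r := (n : ℝ)⁻¹) (by positivity)
      (inv_lt_one_of_one_lt₀ (by linarith))
  refine ⟨_, (h1.sub h2).congr fun l => ?_⟩
  simp only [u]
  field_simp
  ring

/-! ### Contractions, finite orthonormal families and Gram operators -/

/-- Expand each `B e_i` in an orthonormal basis `f_j` of the span and exchange the sums: Bessel
bounds the share of each `f_j` by `‖B† f_j‖² ≤ 1`. Serves both for trace ≤ rank and for the mass in
`H^⊥`. -/
theorem sum_norm_sq_le_finrank_span {E F ι : Type*} [NormedAddCommGroup E]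
    [InnerProductSpace ℂ E] [CompleteSpace E] [NormedAddCommGroup F] [InnerProductSpace ℂ F]
    [CompleteSpace F] (B : E →L[ℂ] F) (hB : ‖B‖ ≤ 1) (e : ι → E) (he : Orthonormal ℂ e)
    (s : Finset ι) :
    ∑ i ∈ s, ‖B (e i)‖ ^ 2 ≤
      (Module.finrank ℂ (Submodule.span ℂ ((fun i => B (e i)) '' (s : Set ι))) : ℝ) := by
  set U := Submodule.span ℂ ((fun i => B (e i)) '' (s : Set ι))
  have : FiniteDimensional ℂ U :=
    FiniteDimensional.span_of_finite ℂ (s.finite_toSet.image _)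
  let f := stdOrthonormalBasis ℂ U
  have h1 : ∀ i ∈ s, ‖B (e i)‖ ^ 2 = ∑ j, ‖inner ℂ (e i) (adjoint B (f j))‖ ^ 2 := by
    intro i hi
    have hm : B (e i) ∈ U := Submodule.subset_span ⟨i, hi, rfl⟩
    have := f.sum_sq_norm_inner_left (⟨B (e i), hm⟩ : U)
    rw [show ‖B (e i)‖ = ‖(⟨B (e i), hm⟩ : U)‖ from rfl, ← this]
    refine Finset.sum_congr rfl fun j _ => ?_
    rw [adjoint_inner_right, Submodule.coe_inner]
  rw [Finset.sum_congr rfl h1, Finset.sum_comm]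
  have h2 : ∀ j, ∑ i ∈ s, ‖inner ℂ (e i) (adjoint B (f j : F))‖ ^ 2 ≤ 1 := by
    intro j
    refine (he.sum_inner_products_le _).trans ?_
    have : ‖adjoint B (f j : F)‖ ≤ 1 := by
      refine (le_opNorm _ _).trans ?_
      rw [LinearIsometryEquiv.norm_map, ← Submodule.coe_norm, f.orthonormal.1 j, mul_one]
      exact hB
    exact pow_le_one₀ (norm_nonneg _) this
  refine (Finset.sum_le_sum fun j _ => h2 j).trans ?_
  simp

/-- `T` maps the finite-dimensional span into itself and is injective there: `T x = 0` gives `∑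
|⟪v_i, x⟫|² = ⟪x, T x⟫ = 0`, so `x` is orthogonal to the span containing it. Injectivity then yields
surjectivity. -/
theorem range_eq_span_of_gram {E ι : Type*} [NormedAddCommGroup E] [InnerProductSpace ℂ E]
    (T : E →ₗ[ℂ] E) (v : ι → E) (s : Finset ι)
    (hT : ∀ x, T x = ∑ i ∈ s, inner ℂ (v i) x • v i) :
    LinearMap.range T = Submodule.span ℂ (v '' (s : Set ι)) := by
  set U := Submodule.span ℂ (v '' (s : Set ι))
  have : FiniteDimensional ℂ U :=
    FiniteDimensional.span_of_finite ℂ (s.finite_toSet.image _)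
  have hmem : ∀ x, T x ∈ U := fun x => by
    rw [hT]
    exact Submodule.sum_mem _ fun i hi => Submodule.smul_mem _ _ (Submodule.subset_span ⟨i, hi, rfl⟩)
  refine le_antisymm (by rintro _ ⟨x, rfl⟩; exact hmem x) ?_
  let T' : U →ₗ[ℂ] U := T.restrict fun x _ => hmem x
  have hinj : Function.Injective T' := by
    rw [← LinearMap.ker_eq_bot, LinearMap.ker_eq_bot']
    intro x hx
    have hx' : T (x : E) = 0 := congrArg Subtype.val hx
    have hsum : ∑ i ∈ s, ‖inner ℂ (v i) (x : E)‖ ^ 2 = 0 := by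
      have h : inner ℂ (x : E) (T x) = ((∑ i ∈ s, ‖inner ℂ (v i) (x : E)‖ ^ 2 : ℝ) : ℂ) := by
        rw [hT, inner_sum]
        push_cast
        refine Finset.sum_congr rfl fun i _ => ?_
        rw [inner_smul_right, ← inner_conj_symm (x : E) (v i)]
        exact RCLike.mul_conj _
      rw [hx', inner_zero_right] at h
      exact_mod_cast h.symm
    have hz : ∀ i ∈ s, inner ℂ (v i) (x : E) = 0 := by
      intro i hi
      have := (Finset.sum_eq_zero_iff_of_nonneg fun i _ => by positivity).mp hsum i hi
      simpa using this
    have hle : U ≤ (ℂ ∙ (x : E))ᗮ := by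
      refine Submodule.span_le.mpr ?_
      rintro _ ⟨i, hi, rfl⟩
      rw [SetLike.mem_coe, Submodule.mem_orthogonal_singleton_iff_inner_left]
      exact hz i hi
    have := Submodule.mem_orthogonal_singleton_iff_inner_left.mp (hle x.2)
    exact Subtype.ext (inner_self_eq_zero.mp this)
  intro y hy
  obtain ⟨x, hx⟩ := (LinearMap.injective_iff_surjective.mp hinj) ⟨y, hy⟩
  exact ⟨x, congrArg Subtype.val hx⟩

/-! ### The creation operators on Fock space -/

theorem inner_fockVec {n : ℕ} (w : FreeMonoid (Fin n)) (y : FockSpace n) :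
    inner ℂ (fockVec w) y = y w := by
  classical
  have := lp.inner_single_left (𝕜 := ℂ) w (1 : ℂ) y
  rw [fockVec]
  convert this using 1
  · simp

theorem fock_ext_inner {n : ℕ} {T S : FockSpace n →L[ℂ] FockSpace n}
    (h : ∀ v w, inner ℂ (fockVec v) (T (fockVec w)) = inner ℂ (fockVec v) (S (fockVec w))) :
    T = S := by
  classical
  refine lp.ext_continuousLinearMap (by simp) fun w => ?_
  ext v
  simp only [inner_fockVec] at h
  simpa [fockVec] using h v w

theorem adjoint_leftCreation_mul {n : ℕ} (i j : Fin n) :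
    adjoint (leftCreation i) * leftCreation j = if i = j then 1 else 0 := by
  classical
  refine fock_ext_inner fun v w => ?_
  have h1 := orthonormal_iff_ite.mp (fockVec_orthonormal n)
  have h2 : FreeMonoid.of i * v = FreeMonoid.of j * w ↔ i = j ∧ v = w := by
    refine ⟨fun h => ?_, fun h => by rw [h.1, h.2]⟩
    have := (consWord n).injective (a₁ := (i, v)) (a₂ := (j, w)) h
    exact Prod.mk.inj this
  rw [mul_apply_eq_comp, adjoint_inner_right, leftCreation_fockVec, leftCreation_fockVec, h1]
  by_cases hij : i = j
  · subst hij
    simp [h2, h1]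
  · simp [h2, hij]

theorem adjoint_leftCreation_fockVec_one {n : ℕ} (i : Fin n) :
    adjoint (leftCreation i) (fockVec (1 : FreeMonoid (Fin n))) = 0 := by
  -- Composing with the rank one projection onto `ξ_1` turns the vector identity into one between
  -- operators, which `fock_ext_inner` can test on matrix coefficients.
  have h : adjoint (leftCreation i) ∘L ((innerSL ℂ (fockVec (1 : FreeMonoid (Fin n)))).smulRight
      (fockVec (1 : FreeMonoid (Fin n)))) = 0 := by
    classical
    refine fock_ext_inner fun v w => ?_
    have h1 := orthonormal_iff_ite.mp (fockVec_orthonormal n)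
    have h2 : FreeMonoid.of i * v ≠ 1 := consWord_ne_one (i, v)
    simp only [coe_comp, Function.comp_apply, smulRight_apply, innerSL_apply_apply, map_smul,
      inner_smul_right, adjoint_inner_right, leftCreation_fockVec, h1, h2, if_false, mul_zero,
      zero_apply, inner_zero_right]
  have := DFunLike.congr_fun h (fockVec 1)
  have h1 : ‖(fockVec (1 : FreeMonoid (Fin n)))‖ = 1 := (fockVec_orthonormal n).1 1
  simpa [h1] using this

theorem adjoint_leftCreation_fockVec_mul {n : ℕ} (i j : Fin n) (w : FreeMonoid (Fin n)) :
    adjoint (leftCreation i) (fockVec (FreeMonoid.of j * w)) = if i = j then fockVec w else 0 := by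
  rw [← leftCreation_fockVec, ← mul_apply_eq_comp, adjoint_leftCreation_mul]
  split_ifs <;> simp

/-- Every nonempty word has a unique first letter, so only `ξ_1` is missed by the ranges of the
`L_i`. -/
theorem sum_leftCreation_adjoint_add {n : ℕ} (y : FockSpace n) :
    ∑ i, leftCreation i (adjoint (leftCreation i) y) + inner ℂ (fockVec 1) y • fockVec 1 = y := by
  classical
  have h : ∑ i, leftCreation i * adjoint (leftCreation i) +
      (innerSL ℂ (fockVec (1 : FreeMonoid (Fin n)))).smulRight
      (fockVec (1 : FreeMonoid (Fin n))) = 1 := by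
    refine fock_ext_inner fun v w => congrArg _ ?_
    have h1 := orthonormal_iff_ite.mp (fockVec_orthonormal n)
    induction w using FreeMonoid.casesOn with
    | one =>
      have h2 : ‖fockVec (1 : FreeMonoid (Fin n))‖ = 1 := (fockVec_orthonormal n).1 1
      simp [adjoint_leftCreation_fockVec_one, h2, sum_apply]
    | of_mul j w =>
      have h2 : (1 : FreeMonoid (Fin n)) ≠ FreeMonoid.of j * w := (consWord_ne_one (j, w)).symm
      simp [adjoint_leftCreation_fockVec_mul, h1, h2, sum_apply, apply_ite, leftCreation_fockVec]
  simpa [sum_apply] using DFunLike.congr_fun h y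

/-- Vectors orthogonal to all words of length less than `p` are moved by `L_w` to vectors
orthogonal to all words of length less than `|w| + p`. -/
theorem inner_fockVec_wordOp_eq_zero {n p : ℕ} {x : FockSpace n}
    (hx : ∀ v : FreeMonoid (Fin n), v.length < p → inner ℂ (fockVec v) x = 0)
    (w : FreeMonoid (Fin n)) :
    ∀ v : FreeMonoid (Fin n), v.length < w.length + p →
      inner ℂ (fockVec v) (wordOp leftCreation w x) = 0 := by
  induction w using FreeMonoid.inductionOn' with
  | one => simpa [wordOp] using hx
  | of_mul i w ih =>
    intro v hv
    rw [wordOp, map_mul, FreeMonoid.lift_eval_of, mul_apply_eq_comp, ← adjoint_inner_left]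
    induction v using FreeMonoid.casesOn with
    | one => rw [adjoint_leftCreation_fockVec_one, inner_zero_left]
    | of_mul j v =>
      rw [adjoint_leftCreation_fockVec_mul]
      split_ifs
      · refine ih v ?_
        simp only [FreeMonoid.length_mul, FreeMonoid.length_of] at hv
        omega
      · exact inner_zero_left _

/-! ### Cyclic subspaces -/

theorem wordOp_mem_adjoin {n : ℕ} (w : FreeMonoid (Fin n)) :
    wordOp leftCreation w ∈ Algebra.adjoin ℂ (Set.range (leftCreation (n := n))) := by
  induction w using FreeMonoid.inductionOn' with
  | one => rw [wordOp, map_one]; exact one_mem _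
  | of_mul i w ih =>
    rw [wordOp, map_mul, FreeMonoid.lift_eval_of]
    exact mul_mem (Algebra.subset_adjoin ⟨i, rfl⟩) ih

theorem adjoin_apply_mem_span {n : ℕ} {T : FockSpace n →L[ℂ] FockSpace n}
    (hT : T ∈ Algebra.adjoin ℂ (Set.range (leftCreation (n := n)))) (x : FockSpace n) :
    T x ∈ Submodule.span ℂ (Set.range fun w => wordOp leftCreation w x) := by
  have hspan : T ∈ Submodule.span ℂ (Set.range (wordOp (leftCreation (n := n)))) := by
    rw [← Subalgebra.mem_toSubmodule, Algebra.adjoin_eq_span] at hT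
    refine Submodule.span_mono ?_ hT
    rw [← FreeMonoid.mrange_lift]
    rintro _ ⟨w, rfl⟩
    exact ⟨w, rfl⟩
  clear hT
  induction hspan using Submodule.span_induction with
  | mem S hS =>
    obtain ⟨w, rfl⟩ := hS
    exact Submodule.subset_span ⟨w, rfl⟩
  | zero => simp
  | add S R _ _ h1 h2 => exact add_mem h1 h2
  | smul c S _ h => exact Submodule.smul_mem _ c h

theorem subset_analyticToeplitz (n : ℕ) :
    (Algebra.adjoin ℂ (Set.range (leftCreation (n := n))) :
      Set (FockSpace n →L[ℂ] FockSpace n)) ⊆ analyticToeplitz n :=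
  fun T hT => subset_closure ⟨T, hT, rfl⟩

/-- For `y` orthogonal to the orbit, `R ↦ ⟪y, R x⟫` is continuous in the weak operator topology and
vanishes on the generated algebra, hence on its closure. -/
theorem analyticToeplitz_apply_mem {n : ℕ} {T : FockSpace n →L[ℂ] FockSpace n}
    (hT : T ∈ analyticToeplitz n) (x : FockSpace n) :
    T x ∈ (Submodule.span ℂ (Set.range fun w => wordOp leftCreation w x)).topologicalClosure := by
  set U := Submodule.span ℂ (Set.range fun w => wordOp leftCreation w x)
  rw [← Submodule.orthogonal_orthogonal_eq_closure, Submodule.mem_orthogonal]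
  intro y hy
  have hcl : IsClosed {R : FockSpace n →WOT[ℂ] FockSpace n | innerSL ℂ y (R x) = 0} :=
    isClosed_eq (ContinuousLinearMapWOT.continuous_dual_apply x (innerSL ℂ y)) continuous_const
  refine closure_minimal ?_ hcl hT
  rintro _ ⟨S, hS, rfl⟩
  exact Submodule.inner_left_of_mem_orthogonal (adjoin_apply_mem_span hS x) hy

theorem IsCyclicInvariant.exists_eq_closure_span {n : ℕ} {M : Submodule ℂ (FockSpace n)}
    (hM : IsCyclicInvariant M) :
    ∃ x, M = (Submodule.span ℂ (Set.range fun w => wordOp leftCreation w x)).topologicalClosure := by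
  obtain ⟨hinv, x, hx, hcl⟩ := hM
  refine ⟨x, le_antisymm ?_ ?_⟩
  · intro y hy
    have hy' : y ∈ closure {y | ∃ T ∈ analyticToeplitz n, y = T x} := hcl ▸ hy
    refine closure_minimal ?_ (Submodule.isClosed_topologicalClosure _) hy'
    rintro _ ⟨T, hT, rfl⟩
    exact analyticToeplitz_apply_mem hT x
  · refine Submodule.topologicalClosure_minimal _ ?_ (by rw [hcl]; exact isClosed_closure)
    rw [Submodule.span_le]
    rintro _ ⟨w, rfl⟩
    exact hinv _ (subset_analyticToeplitz n (wordOp_mem_adjoin w)) x hx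

/-- Density bound for a cyclic subspace of vectors orthogonal to the words of length less
than `p`. -/
theorem sum_norm_sq_starProjection_le {n p : ℕ} (x : FockSpace n) (M : Submodule ℂ (FockSpace n))
    [M.HasOrthogonalProjection]
    (hM : M = (Submodule.span ℂ (Set.range fun w => wordOp leftCreation w x)).topologicalClosure)
    (hx : ∀ v : FreeMonoid (Fin n), v.length < p → inner ℂ (fockVec v) x = 0) (j : ℕ) :
    ∑ w ∈ shortWords n (j + p), ‖M.starProjection (fockVec w)‖ ^ 2 ≤ (shortWords n j).card := by
  let g : FreeMonoid (Fin n) → FockSpace n := fun w => wordOp leftCreation w x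
  have hgM : ∀ w, g w ∈ M := fun w => by
    rw [hM]
    exact Submodule.le_topologicalClosure _ (Submodule.subset_span ⟨w, rfl⟩)
  -- The tail of the orbit. Modulo `N`, only the finitely many orbit vectors with `|w| < j` survive
  -- in `M`; `G` is their image.
  let N := (Submodule.span ℂ (g '' {w | j ≤ w.length})).topologicalClosure
  have hNM : N ≤ M := by
    rw [hM]
    exact Submodule.topologicalClosure_mono (Submodule.span_mono (Set.image_subset_range _ _))
  let Q := Nᗮ.starProjection
  let G := Submodule.span ℂ ((fun w => Q (g w)) '' (shortWords n j : Set (FreeMonoid (Fin n))))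
  have hfin : FiniteDimensional ℂ G :=
    FiniteDimensional.span_of_finite ℂ ((shortWords n j).finite_toSet.image _)
  have hMG : ∀ y ∈ M, Q y ∈ G := by
    have hle : M ≤ G.comap (Q : FockSpace n →ₗ[ℂ] FockSpace n) := by
      rw [hM]
      refine Submodule.topologicalClosure_minimal _ ?_
        ((Submodule.closed_of_finiteDimensional G).preimage Q.continuous)
      rw [Submodule.span_le]
      rintro _ ⟨w, rfl⟩
      rw [SetLike.mem_coe, Submodule.mem_comap]
      by_cases hw : w.length < j
      · exact Submodule.subset_span ⟨w, (mem_shortWords j w).mpr hw, rfl⟩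
      · have : g w ∈ N := Submodule.le_topologicalClosure _
          (Submodule.subset_span ⟨w, not_lt.mp hw, rfl⟩)
        have h0 : Q (g w) = 0 := by
          rw [Submodule.starProjection_apply_eq_zero_iff]
          exact Submodule.le_orthogonal_orthogonal N this
        change Q (g w) ∈ G
        rw [h0]
        exact zero_mem _
    exact hle
  have hproj : ∀ w ∈ shortWords n (j + p), M.starProjection (fockVec w) ∈ G := by
    intro w hw
    have hwl := (mem_shortWords _ _).mp hw
    -- Each generator of `N` has `|v| ≥ j`, so it is orthogonal to all words of length less than `j
    -- + p`.
    have h1 : fockVec w ∈ Nᗮ := by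
      rw [Submodule.orthogonal_closure, Submodule.mem_orthogonal]
      intro u hu
      induction hu using Submodule.span_induction with
      | mem u hu =>
        obtain ⟨v, hv, rfl⟩ := hu
        rw [← inner_conj_symm, inner_fockVec_wordOp_eq_zero hx v w, map_zero]
        have : j ≤ v.length := hv
        omega
      | zero => exact inner_zero_left _
      | add a b _ _ ha hb => rw [inner_add_left, ha, hb, add_zero]
      | smul c a _ ha => rw [inner_smul_left, ha, mul_zero]
    -- Since `N ≤ M`, projecting onto `M` does not change inner products with vectors of `N`.
    have h2 : M.starProjection (fockVec w) ∈ Nᗮ := by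
      rw [Submodule.mem_orthogonal] at h1 ⊢
      intro u hu
      rw [← Submodule.inner_starProjection_left_eq_right,
        Submodule.starProjection_eq_self_iff.mpr (hNM hu)]
      exact h1 u hu
    rw [← Submodule.starProjection_eq_self_iff.mpr h2]
    exact hMG _ (Submodule.starProjection_apply_mem _ _)
  refine (sum_norm_sq_le_finrank_span M.starProjection M.starProjection_norm_le _
    (fockVec_orthonormal n) _).trans ?_
  have hle : Submodule.span ℂ ((fun w => M.starProjection (fockVec w)) ''
      (shortWords n (j + p) : Set (FreeMonoid (Fin n)))) ≤ G := by
    rw [Submodule.span_le]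
    rintro _ ⟨w, hw, rfl⟩
    exact hproj w hw
  have h1 := Submodule.finrank_mono hle
  classical
  have h2 : Module.finrank ℂ G ≤ (shortWords n j).card := by
    have := finrank_span_finset_le_card (R := ℂ) ((shortWords n j).image fun w => Q (g w))
    rw [Finset.coe_image] at this
    exact this.trans Finset.card_image_le
  exact_mod_cast h1.trans h2

/-! ### Compressions of the creation operators -/

section Compression

variable {n : ℕ} {H : Type*} [NormedAddCommGroup H] [InnerProductSpace ℂ H] [CompleteSpace H]
  {A : Fin n → (H →L[ℂ] H)} {V : H →ₗᵢ[ℂ] FockSpace n}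

/-- The compression to `H` of the basis vector `ξ_w`. -/
noncomputable def compressedVec (V : H →ₗᵢ[ℂ] FockSpace n) (w : FreeMonoid (Fin n)) : H :=
  adjoint V.toContinuousLinearMap (fockVec w)

theorem adjoint_isometry_apply (V : H →ₗᵢ[ℂ] FockSpace n) (x : H) :
    adjoint V.toContinuousLinearMap (V x) = x := by
  refine ext_inner_right ℂ fun z => ?_
  rw [adjoint_inner_left]
  exact V.inner_map_map x z

theorem inner_compressedVec (w : FreeMonoid (Fin n)) (x : H) :
    inner ℂ (compressedVec V w) x = inner ℂ (fockVec w) (V x) :=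
  adjoint_inner_left _ _ _

/-- Co-invariance upgrades compression to intertwining: `L_i† V z` stays in the range of `V`, so
inner products with it see only the component of `y` in `H`. -/
theorem apply_adjoint_isometry (h : IsMinimalIsometricDilation A (leftCreation (n := n)) V)
    (i : Fin n) (y : FockSpace n) :
    A i (adjoint V.toContinuousLinearMap y) =
      adjoint V.toContinuousLinearMap (leftCreation i y) := by
  refine ext_inner_right ℂ fun z => ?_
  obtain ⟨u, hu⟩ := h.coinvariant i z
  have hu' : V u = adjoint (leftCreation i) (V z) := hu
  rw [h.compression, adjoint_inner_left, adjoint_inner_left, ← adjoint_inner_right,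
    ← adjoint_inner_right]
  change inner ℂ _ (adjoint (leftCreation i) (V z)) = inner ℂ y (adjoint (leftCreation i) (V z))
  rw [← hu', V.inner_map_map, adjoint_inner_left]
  rfl

theorem apply_compressedVec (h : IsMinimalIsometricDilation A (leftCreation (n := n)) V)
    (i : Fin n) (w : FreeMonoid (Fin n)) :
    A i (compressedVec V w) = compressedVec V (FreeMonoid.of i * w) := by
  rw [compressedVec, apply_adjoint_isometry h, leftCreation_fockVec]
  rfl

theorem isometry_adjoint_apply (h : IsMinimalIsometricDilation A (leftCreation (n := n)) V)
    (i : Fin n) (x : H) :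
    V (adjoint (A i) x) = adjoint (leftCreation i) (V x) := by
  refine ext_inner_left ℂ fun y => ?_
  rw [adjoint_inner_right]
  refine (adjoint_inner_left V.toContinuousLinearMap (adjoint (A i) x) y).symm.trans ?_
  rw [adjoint_inner_right, apply_adjoint_isometry h, adjoint_inner_left]
  rfl

theorem sum_apply_adjoint_add (h : IsMinimalIsometricDilation A (leftCreation (n := n)) V)
    (x : H) :
    ∑ i, A i (adjoint (A i) x) + inner ℂ (compressedVec V 1) x • compressedVec V 1 = x := by
  have h1 := congrArg (adjoint V.toContinuousLinearMap) (sum_leftCreation_adjoint_add (V x))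
  rw [map_add, map_sum, map_smul, adjoint_isometry_apply] at h1
  rw [inner_compressedVec]
  refine Eq.trans ?_ h1
  congr 1
  refine Finset.sum_congr rfl fun i _ => ?_
  rw [← apply_adjoint_isometry h, ← isometry_adjoint_apply h, adjoint_isometry_apply]

/-- Follows the recursion `I - Φ^(l+1)(I) = (I - Φ(I)) + Φ(I - Φ^l(I))`: the first term supplies the
empty word, and `Φ` prepends a letter to each word because `A_i P ξ_w = P ξ_{iw}`. -/
theorem defect_apply (h : IsMinimalIsometricDilation A (leftCreation (n := n)) V) (l : ℕ)
    (x : H) :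
    defect A l x =
      ∑ w ∈ shortWords n l, inner ℂ (compressedVec V w) x • compressedVec V w := by
  induction l generalizing x with
  | zero => simp [defect, shortWords]
  | succ l ih =>
    have h1 : defect A (l + 1) x =
        x - ∑ i, A i (adjoint (A i) x) + ∑ i, A i (defect A l (adjoint (A i) x)) := by
      rw [defect, Function.iterate_succ_apply']
      simp only [defect, cpMap, sub_apply, sum_apply, mul_apply_eq_comp, one_apply_eq_self,
        map_sub, Finset.sum_sub_distrib]
      abel
    rw [h1, sum_shortWords_succ]
    nth_rewrite 1 [← sum_apply_adjoint_add h x]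
    rw [add_sub_cancel_left]
    congr 1
    refine Finset.sum_congr rfl fun i _ => ?_
    rw [ih, map_sum]
    refine Finset.sum_congr rfl fun w _ => ?_
    rw [map_smul, adjoint_inner_right, apply_compressedVec h]

theorem norm_adjoint_isometry_le (V : H →ₗᵢ[ℂ] FockSpace n) :
    ‖adjoint V.toContinuousLinearMap‖ ≤ 1 := by
  rw [LinearIsometryEquiv.norm_map]
  exact V.norm_toContinuousLinearMap_le

theorem norm_apply_le (h : IsMinimalIsometricDilation A (leftCreation (n := n)) V) (i : Fin n)
    (x : H) : ‖A i x‖ ≤ ‖x‖ := by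
  rw [h.compression]
  refine ((adjoint V.toContinuousLinearMap).le_of_opNorm_le (norm_adjoint_isometry_le V) _).trans ?_
  rw [one_mul]
  refine le_of_eq ?_
  rw [leftCreation]
  exact (LinearIsometry.norm_map _ _).trans (V.norm_map x)

theorem norm_compressedVec_le (V : H →ₗᵢ[ℂ] FockSpace n) (w : FreeMonoid (Fin n)) :
    ‖compressedVec V w‖ ≤ 1 := by
  refine ((adjoint V.toContinuousLinearMap).le_of_opNorm_le (norm_adjoint_isometry_le V) _).trans ?_
  rw [one_mul, (fockVec_orthonormal n).1 w]

/-- The trace of the `l`-th defect operator, as a real number. -/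
noncomputable def defectTrace (V : H →ₗᵢ[ℂ] FockSpace n) (l : ℕ) : ℝ :=
  ∑ w ∈ shortWords n l, ‖compressedVec V w‖ ^ 2

/-- The range of the `l`-th defect operator. -/
def defectSpan (V : H →ₗᵢ[ℂ] FockSpace n) (l : ℕ) : Submodule ℂ H :=
  Submodule.span ℂ (compressedVec V '' (shortWords n l : Set (FreeMonoid (Fin n))))

instance (V : H →ₗᵢ[ℂ] FockSpace n) (l : ℕ) : FiniteDimensional ℂ (defectSpan V l) :=
  FiniteDimensional.span_of_finite ℂ ((shortWords n l).finite_toSet.image _)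

/-- By Parseval, the rank one operator of a vector `v` has trace `‖v‖²`. -/
theorem opTrace_defect (h : IsMinimalIsometricDilation A (leftCreation (n := n)) V) (l : ℕ) :
    opTrace (defect A l) = ENNReal.ofReal (defectTrace V l) := by
  have h1 : ∀ x, ENNReal.ofReal ((defect A l).reApplyInnerSelf x) =
      ∑ w ∈ shortWords n l, ENNReal.ofReal (‖inner ℂ x (compressedVec V w)‖ ^ 2) := by
    intro x
    rw [← ENNReal.ofReal_sum_of_nonneg fun w _ => by positivity]
    congr 1
    rw [reApplyInnerSelf_apply, defect_apply h, sum_inner, map_sum]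
    refine Finset.sum_congr rfl fun w _ => ?_
    rw [inner_smul_left, inner_conj_symm, inner_mul_symm_re_eq_norm, norm_mul,
      norm_inner_symm (compressedVec V w) x, sq]
  rw [opTrace, tsum_congr fun i => h1 _, Summable.tsum_finsetSum fun w _ => ENNReal.summable,
    defectTrace, ENNReal.ofReal_sum_of_nonneg fun w _ => by positivity]
  exact Finset.sum_congr rfl fun w _ => hilbertBasis_tsum_ofReal _ _

theorem opRank_defect (h : IsMinimalIsometricDilation A (leftCreation (n := n)) V) (l : ℕ) :
    opRank (defect A l) = (Module.finrank ℂ (defectSpan V l) : ℕ∞) := by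
  have h1 := range_eq_span_of_gram (defect A l : H →ₗ[ℂ] H) (compressedVec V) (shortWords n l)
    (defect_apply h l)
  rw [opRank, LinearMap.rank, h1]
  change Cardinal.toENat (Module.rank ℂ (defectSpan V l)) = _
  rw [← Module.finrank_eq_rank, map_natCast]

theorem defectTrace_nonneg (V : H →ₗᵢ[ℂ] FockSpace n) (l : ℕ) : 0 ≤ defectTrace V l :=
  Finset.sum_nonneg fun _ _ => by positivity

theorem defectTrace_succ_le (h : IsMinimalIsometricDilation A (leftCreation (n := n)) V)
    (l : ℕ) : defectTrace V (l + 1) ≤ 1 + n * defectTrace V l := by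
  rw [defectTrace, sum_shortWords_succ]
  refine add_le_add (pow_le_one₀ (norm_nonneg _) (norm_compressedVec_le V 1)) ?_
  have h1 : ∀ i ∈ (Finset.univ : Finset (Fin n)),
      ∑ w ∈ shortWords n l, ‖compressedVec V (FreeMonoid.of i * w)‖ ^ 2 ≤ defectTrace V l := by
    intro i _
    refine Finset.sum_le_sum fun w _ => ?_
    rw [← apply_compressedVec h]
    exact pow_le_pow_left₀ (norm_nonneg _) (norm_apply_le h i _) 2
  refine (Finset.sum_le_sum h1).trans ?_
  simp

theorem finrank_defectSpan_succ_le (h : IsMinimalIsometricDilation A (leftCreation (n := n)) V)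
    (l : ℕ) :
    Module.finrank ℂ (defectSpan V (l + 1)) ≤ 1 + n * Module.finrank ℂ (defectSpan V l) := by
  -- Its range contains `P ξ_1` and each `A_i` of the previous span, and its domain has the
  -- dimension sought.
  let φ : (ℂ × (Fin n → defectSpan V l)) →ₗ[ℂ] H :=
    (LinearMap.toSpanSingleton ℂ H (compressedVec V 1)).coprod
      (∑ i, (A i : H →ₗ[ℂ] H) ∘ₗ (defectSpan V l).subtype ∘ₗ LinearMap.proj i)
  have hle : defectSpan V (l + 1) ≤ LinearMap.range φ := by
    refine Submodule.span_le.mpr ?_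
    rintro _ ⟨w, hw, rfl⟩
    have hw' := (mem_shortWords _ _).mp hw
    induction w using FreeMonoid.casesOn with
    | one => exact ⟨(1, 0), by simp [φ]⟩
    | of_mul j w =>
      rw [FreeMonoid.length_mul, FreeMonoid.length_of] at hw'
      have hm : compressedVec V w ∈ defectSpan V l :=
        Submodule.subset_span ⟨w, (mem_shortWords _ _).mpr (by omega), rfl⟩
      refine ⟨(0, Pi.single j ⟨_, hm⟩), ?_⟩
      simp only [φ, LinearMap.coprod_apply, map_zero, zero_add, LinearMap.sum_apply,
        LinearMap.comp_apply, LinearMap.proj_apply]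
      rw [Finset.sum_eq_single j]
      · rw [Pi.single_eq_same]
        exact apply_compressedVec h j w
      · intro i _ hij
        rw [Pi.single_eq_of_ne hij, map_zero, map_zero]
      · simp
  refine (Submodule.finrank_mono hle).trans ((LinearMap.finrank_range_le φ).trans ?_)
  simp [Module.finrank_pi_fintype]

theorem defectTrace_le_finrank (V : H →ₗᵢ[ℂ] FockSpace n) (l : ℕ) :
    defectTrace V l ≤ Module.finrank ℂ (defectSpan V l) :=
  sum_norm_sq_le_finrank_span (adjoint V.toContinuousLinearMap) (norm_adjoint_isometry_le V) _
    (fockVec_orthonormal n) _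

/-- The condition `1 ≤ n` makes the truncated `n - 1` agree with the real one. -/
theorem natCast_sub_one_mul_ofReal_div (hn : 1 ≤ n) (s : ℝ) (l : ℕ) :
    ((n - 1 : ℕ) : ℝ≥0∞) * (ENNReal.ofReal s / (n : ℝ≥0∞) ^ l) =
      ENNReal.ofReal (((n : ℝ) - 1) * (s / (n : ℝ) ^ l)) := by
  have hn' : (1 : ℝ) ≤ n := by exact_mod_cast hn
  rw [ENNReal.ofReal_mul (by linarith), ENNReal.ofReal_div_of_pos (by positivity),
    ENNReal.ofReal_pow (by positivity), ENNReal.ofReal_natCast, ← ENNReal.ofReal_natCast (n - 1),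
    Nat.cast_sub hn, Nat.cast_one]

theorem curvatureSeq_eq (hn : 1 ≤ n)
    (h : IsMinimalIsometricDilation A (leftCreation (n := n)) V) (l : ℕ) :
    curvatureSeq A l = ENNReal.ofReal (((n : ℝ) - 1) * (defectTrace V l / (n : ℝ) ^ l)) := by
  rw [curvatureSeq, opTrace_defect h, natCast_sub_one_mul_ofReal_div hn]

theorem eulerSeq_eq (hn : 1 ≤ n)
    (h : IsMinimalIsometricDilation A (leftCreation (n := n)) V) (l : ℕ) :
    eulerSeq A l = ENNReal.ofReal
      (((n : ℝ) - 1) * ((Module.finrank ℂ (defectSpan V l) : ℝ) / (n : ℝ) ^ l)) := by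
  rw [← natCast_sub_one_mul_ofReal_div hn, eulerSeq, opRank_defect h, ENNReal.ofReal_natCast,
    ENat.toENNReal_coe]

theorem norm_sq_compressedVec_add (V : H →ₗᵢ[ℂ] FockSpace n) (w : FreeMonoid (Fin n)) :
    ‖compressedVec V w‖ ^ 2 +
      ‖(LinearMap.range V.toLinearMap)ᗮ.starProjection (fockVec w)‖ ^ 2 = 1 := by
  have : CompleteSpace (LinearMap.range V.toLinearMap) :=
    (V.isometry.isClosedEmbedding.isClosed_range).completeSpace_coe
  have h1 : (LinearMap.range V.toLinearMap).starProjection (fockVec w) =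
      V (compressedVec V w) := by
    refine Submodule.eq_starProjection_of_mem_orthogonal ⟨_, rfl⟩ ?_
    rw [Submodule.mem_orthogonal]
    rintro _ ⟨x, rfl⟩
    change inner ℂ (V x) (fockVec w - V (compressedVec V w)) = 0
    rw [inner_sub_right, V.inner_map_map, compressedVec, adjoint_inner_right]
    exact sub_self _
  have h2 := Submodule.norm_sq_eq_add_norm_sq_starProjection (fockVec w)
    (LinearMap.range V.toLinearMap)
  rw [h1, V.norm_map, (fockVec_orthonormal n).1 w] at h2
  linarith

/-- Each `ξ_w` splits its unit mass between `H` and `H^⊥`, so the bound on the mass in `H^⊥` leaves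
the rest to the trace. -/
theorem le_defectTrace {p : ℕ} (hcyc : IsCyclicInvariant (LinearMap.range V.toLinearMap)ᗮ)
    (hp : ∀ w : FreeMonoid (Fin n), w.length < p → fockVec w ∈ LinearMap.range V.toLinearMap)
    (j : ℕ) :
    ((shortWords n (j + p)).card : ℝ) - (shortWords n j).card ≤ defectTrace V (j + p) := by
  obtain ⟨x, hx⟩ := hcyc.exists_eq_closure_span
  have hxM : x ∈ (LinearMap.range V.toLinearMap)ᗮ := by
    rw [hx]
    exact Submodule.le_topologicalClosure _ (Submodule.subset_span ⟨1, by simp [wordOp]⟩)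
  have h1 := sum_norm_sq_starProjection_le (p := p) x _ hx
    (fun v hv => Submodule.inner_right_of_mem_orthogonal (hp v hv) hxM) j
  have h2 := Finset.sum_congr rfl fun w (_ : w ∈ shortWords n (j + p)) =>
    norm_sq_compressedVec_add V w
  rw [Finset.sum_add_distrib, Finset.sum_const, nsmul_eq_mul, mul_one] at h2
  rw [defectTrace]
  linarith

end Compression

theorem mainTheorem7 {n : ℕ} (hn : 2 ≤ n)
    {H : Type*} [NormedAddCommGroup H] [InnerProductSpace ℂ H] [CompleteSpace H]
    (A : Fin n → (H →L[ℂ] H)) (hpure : IsPureContraction A) (hrank : HasPureRank A 1)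
    (V : H →ₗᵢ[ℂ] FockSpace n)
    (hdil : IsMinimalIsometricDilation A (leftCreation (n := n)) V)
    (hcyc : IsCyclicInvariant (LinearMap.range V.toLinearMap)ᗮ)
    (k : ℕ)
    (hk : Submodule.span ℂ {x | ∃ w : FreeMonoid (Fin n), w.length ≤ k ∧ x = fockVec w} ≤
      LinearMap.range V.toLinearMap) :
    Tendsto (curvatureSeq A) atTop (𝓝 (curvatureInvariant A)) ∧
    Tendsto (eulerSeq A) atTop (𝓝 (eulerCharacteristic A)) ∧
    curvatureInvariant A ≤ eulerCharacteristic A ∧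
    1 - 1 / (n : ℝ≥0∞) ^ k < curvatureInvariant A := by
  have hn1 : 1 ≤ n := by omega
  have hnR : (2 : ℝ) ≤ n := by exact_mod_cast hn
  obtain ⟨c, hc⟩ := exists_tendsto_of_le_one_add_mul hn (defectTrace V) (defectTrace_nonneg V)
    (defectTrace_succ_le hdil)
  obtain ⟨e, he⟩ := exists_tendsto_of_le_one_add_mul hn
    (fun l => (Module.finrank ℂ (defectSpan V l) : ℝ)) (fun l => Nat.cast_nonneg _)
    (fun l => by exact_mod_cast finrank_defectSpan_succ_le hdil l)
  have hcE : Tendsto (curvatureSeq A) atTop (𝓝 (ENNReal.ofReal c)) :=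
    (ENNReal.tendsto_ofReal hc).congr fun l => (curvatureSeq_eq hn1 hdil l).symm
  have heE : Tendsto (eulerSeq A) atTop (𝓝 (ENNReal.ofReal e)) :=
    (ENNReal.tendsto_ofReal he).congr fun l => (eulerSeq_eq hn1 hdil l).symm
  have hK : curvatureInvariant A = ENNReal.ofReal c := hcE.limUnder_eq
  have hX : eulerCharacteristic A = ENNReal.ofReal e := heE.limUnder_eq
  rw [hK, hX]
  refine ⟨hcE, heE, ENNReal.ofReal_le_ofReal (le_of_tendsto_of_tendsto' hc he fun l => ?_), ?_⟩
  · have := defectTrace_le_finrank V l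
    have h0 : (0 : ℝ) ≤ n - 1 := by linarith
    gcongr
  -- Length at most `k` means length less than `k + 1`, so `p = k + 1`. This extra power of `n` is
  -- what makes the final inequality strict.
  have hlow : 1 - 1 / (n : ℝ) ^ (k + 1) ≤ c := by
    refine ge_of_tendsto hc ?_
    filter_upwards [eventually_ge_atTop (k + 1)] with l hl
    obtain ⟨j, rfl⟩ := Nat.exists_eq_add_of_le' hl
    have h1 := le_defectTrace hcyc (p := k + 1)
      (fun w hw => hk (Submodule.subset_span ⟨w, by omega, rfl⟩)) j
    have h2 := mul_le_mul_of_nonneg_left h1 (by linarith : (0 : ℝ) ≤ n - 1)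
    rw [mul_sub, card_shortWords, card_shortWords] at h2
    rw [← mul_div_assoc, le_div_iff₀ (by positivity)]
    refine le_trans (le_of_eq ?_) h2
    rw [pow_add]
    field_simp
    ring
  have hlt : 1 - 1 / (n : ℝ) ^ k < 1 - 1 / (n : ℝ) ^ (k + 1) := by
    have : (n : ℝ) ^ k < (n : ℝ) ^ (k + 1) := pow_lt_pow_right₀ (by linarith) (by omega)
    have := one_div_lt_one_div_of_lt (by positivity) this
    linarith
  -- Ensures `0 ≤ 1 - 1 / n^k < c`; positivity of `c` is needed for `ENNReal.ofReal` to preserve the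
  -- strict inequality.
  have hle : 1 / (n : ℝ) ^ k ≤ 1 := by
    rw [div_le_one (by positivity)]
    exact one_le_pow₀ (by linarith)
  have heq : 1 - 1 / (n : ℝ≥0∞) ^ k = ENNReal.ofReal (1 - 1 / (n : ℝ) ^ k) := by
    rw [ENNReal.ofReal_sub _ (by positivity), ENNReal.ofReal_one,
      ENNReal.ofReal_div_of_pos (by positivity), ENNReal.ofReal_one,
      ENNReal.ofReal_pow (by positivity), ENNReal.ofReal_natCast]
  rw [heq]
  exact (ENNReal.ofReal_lt_ofReal_iff (by linarith)).mpr (by linarith)
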